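/- Let $K$ be an infinite field and let $n,d$ be non-negative integers with $\frac{4(n^2+n)}{9}\le d\le n^2$. For $c=(c_{j,k,m})\in K^{n^2d}$ ($1\le j\le d$, $1\le k,m\le n$) put $f_j=\sum_{k,m=1}^n c_{j,k,m}x_kx_m$ and let $R_c=K\langle x_1,\dots,x_n\rangle/(f_1,\dots,f_d)$ be the quotient of the free associative algebra by the two-sided ideal generated by $f_1,\dots,f_d$, graded by $\deg x_i=1$, with Hilbert series $H_{R_c}(t)=\sum_{q\ge 0}\dim_K (R_c)_q\,t^q$. For a power series $a(t)\in\mathbb{Z}[[t]]$ let $|a(t)|$ denote the series obtained by replacing all coefficients, starting from the first negative one, by zero. Then: (1) $|(1-nt+dt^2)^{-1}|=1+nt+(n^2-d)t^2+\max(0,\,n^3-2nd)\,t^3$. (2) A generic quadratic algebra with $n$ generators and $d$ relations attains the Golod–Shafarevich bound: there is a dense Zariski open set $U\subseteq K^{n^2d}$ such that for every $c\in U$ the relations $f_1,\dots,f_d$ are linearly independent and $H_{R_c}(t)=|(1-nt+dt^2)^{-1}|$. (3) For every $q\ge 0$, the minimum of $\dim_K (R_c)_q$ over all $c$ with $f_1,\dots,f_d$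 linearly independent equals the coefficient of $t^q$ in $|(1-nt+dt^2)^{-1}|$. So Anick's conjecture holds in this range. -/

import Mathlib

noncomputable section

namespace QuadAlg

/-- The Zariski topology on the affine space `K^σ`: the closed sets are the common zero sets of
families of polynomials. -/
@[reducible] def zariski (K : Type*) [Field K] (σ : Type*) : TopologicalSpace (σ → K) :=
  TopologicalSpace.ofClosed
    {Z | ∃ S : Set (MvPolynomial σ K), Z = {x | ∀ p ∈ S, MvPolynomial.eval x p = 0}}
    ⟨{1}, by ext x; simp⟩
    (by
      intro A hA
      refine ⟨{p | ∃ Z ∈ A, ∀ x ∈ Z, MvPolynomial.eval x p = 0}, ?_⟩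
      ext x
      simp only [Set.mem_sInter, Set.mem_ofPred_eq]
      constructor
      · rintro h p ⟨Z, hZ, hp⟩
        exact hp x (h Z hZ)
      · intro h Z hZ
        obtain ⟨S, rfl⟩ := hA hZ
        intro p hp
        exact h p ⟨_, hZ, fun y hy => hy p hp⟩)
    (by
      rintro _ ⟨S, rfl⟩ _ ⟨T, rfl⟩
      refine ⟨{p | ∃ s ∈ S, ∃ t ∈ T, p = s * t}, ?_⟩
      ext x
      simp only [Set.mem_union, Set.mem_ofPred_eq]
      constructor
      · rintro (h | h) p ⟨s, hs, t, ht, rfl⟩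
        · simp [h s hs]
        · simp [h t ht]
      · intro h
        by_contra! hne
        obtain ⟨⟨s, hs, hs0⟩, t, ht, ht0⟩ := hne
        have h0 := h (s * t) ⟨s, hs, t, ht, rfl⟩
        rw [map_mul] at h0
        exact (mul_ne_zero hs0 ht0) h0)

/-- A property of points of affine space holds generically if the set of points having it contains
a dense Zariski open set. -/
def Generically {K : Type*} [Field K] {σ : Type*} (P : (σ → K) → Prop) : Prop :=
  ∃ U : Set (σ → K), @IsOpen _ (zariski K σ) U ∧ @Dense _ (zariski K σ) U ∧ ∀ c ∈ U, P c

/-- The coefficient space `K^{d n²}` of `d`-tuples of quadratic noncommutative forms in `n`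
variables. -/
abbrev Coeffs (K : Type*) (n d : ℕ) : Type _ := Fin d × Fin n × Fin n → K

variable {K : Type*} [Field K] {n d : ℕ}

/-- The `j`-th relation `∑ c_{j,k,m} x_k x_m`. -/
def relation (c : Coeffs K n d) (j : Fin d) : FreeAlgebra K (Fin n) :=
  ∑ k : Fin n, ∑ m : Fin n, c (j, k, m) • (FreeAlgebra.ι K k * FreeAlgebra.ι K m)

/-- The two-sided ideal generated by the relations. -/
def relIdeal (c : Coeffs K n d) : TwoSidedIdeal (FreeAlgebra K (Fin n)) :=
  TwoSidedIdeal.span (Set.range (relation c))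

/-- The quadratic algebra `K⟨x_1,…,x_n⟩ / Id(f_1,…,f_d)`. -/
abbrev QuadraticAlg (c : Coeffs K n d) : Type _ := (relIdeal c).ringCon.Quotient

/-- The degree `q` component of the free algebra: the span of the words of length `q`. -/
def freeComponent (K : Type*) [Field K] (n q : ℕ) : Submodule K (FreeAlgebra K (Fin n)) :=
  Submodule.span K
    (Set.range fun w : Fin q → Fin n => (List.ofFn fun i => FreeAlgebra.ι K (w i)).prod)

/-- The degree `q` component of the quadratic algebra: the image of the degree `q` component
of the free algebra. -/
def component (c : Coeffs K n d) (q : ℕ) : Submodule K (QuadraticAlg c) :=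
  (freeComponent K n q).map ((relIdeal c).ringCon.mkₐ K).toLinearMap

/-- The dimension of the degree `q` component. -/
def componentDim (c : Coeffs K n d) (q : ℕ) : ℕ := Module.finrank K (component c q)

/-- The Hilbert series `∑ (dim R_q) t^q`. -/
def hilbertSeries (c : Coeffs K n d) : PowerSeries ℤ :=
  PowerSeries.mk fun q => (componentDim c q : ℤ)

open Classical in
/-- The series `|a|`: all coefficients from the first negative one on are replaced by zero. -/
def truncAtNeg (a : PowerSeries ℤ) : PowerSeries ℤ :=
  PowerSeries.mk fun q => if ∃ j ≤ q, PowerSeries.coeff j a < 0 then 0 else PowerSeries.coeff q a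

/-- The Golod–Shafarevich series `|(1 - n t + d t²)⁻¹|`. -/
def golodShafarevich (n d : ℕ) : PowerSeries ℤ :=
  truncAtNeg (PowerSeries.invOfUnit
    (1 - (n : PowerSeries ℤ) * PowerSeries.X + (d : PowerSeries ℤ) * PowerSeries.X ^ 2) 1)

end QuadAlg

end

/-!
Fix `c` and let `I` be the ideal of relations. The degree `q` part of `I` is spanned by the products
`u f_j v` with `u`, `v` words of total length `q - 2`, so the dimension of the degree `q` component
is `n ^ q` minus the rank of a family of vectors whose coordinates are linear forms in `c`
(`componentDim_add_finrank`). Two things follow. The dimensions in degrees `0`, `1`, `2` are forced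
once the relations are independent, and in degree three there are only `2 n d` such vectors, so the
dimension is at least `n ^ 3 - 2 n d`. And the rank can only drop on a proper Zariski closed set, so
the Hilbert function is upper semicontinuous (`exists_polynomial_componentDim_le`).

For `9 d ≥ 4 (n ^ 2 + n)` the Golod–Shafarevich series vanishes from degree four on, because the
coefficient `n ^ 4 - 3 n ^ 2 d + d ^ 2` of `t ^ 4` is negative whenever that of `t ^ 3` is
non-negative and `n > 0`. By semicontinuity it therefore suffices to find, separately, one algebra
with independent relations, one with the predicted dimension in degree three, and one whose degree
four component is zero; a product of the corresponding polynomials then cuts out the open set,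
which is dense since `K` is infinite.

* If `2 d ≥ n ^ 2`, the degree three component can be made zero. Split the generators into blocks
  `a_s`, `b_s` of equal size and at most one further generator `z`, with relations `a_s b_t = 0`,
  `a_s a_t = b_s b_t`, `a_s z = z (a_s + b_s)`, `b_s z = z b_s`, `z z = 0`
  (`exists_componentDim_three_eq_zero`).
* If `2 d ≤ n ^ 2`, take `n ^ 2 - d` relations of the preceding kind, and `d` independent relations
  orthogonal to them. A linear dependence among the products `x_i f_j`, `f_j x_i` gives a tensor
  orthogonal to everything in degree three, so there is none and the dimension is
  `n ^ 3 - 2 n d` (`exists_componentDim_three_eq`).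
* If `2 d < n ^ 2`, degree four is killed by splitting the generators into three blocks `a_s`, `b_s`,
  `c_s` of equal size and at most two further generators `z_l`, with relations `a_s b_t = 0`,
  `a_s c_t = 0`, `a_s a_t = b_s c_t`, `b_s b_t = c_s c_t`, `a_s z_l = z_l b_s`, `b_s z_l = z_l c_s`,
  `c_s z_l = z_l a_s`, `z_l z_l' = 0` (`exists_componentDim_four_eq_zero`). In both constructions
  moving `z` to the left across a relation yields a second, transformed copy of that relation behind
  `z`, which is why the extra generators do not spoil nilpotency.
-/

namespace QuadAlg

open Module

variable {K : Type*} [Field K] {n d : ℕ}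

/-! ### Coordinates in the free algebra -/

/-- The monomial of the free algebra spelled by a list of letters. -/
noncomputable def word (K : Type*) [Field K] {n : ℕ} (l : List (Fin n)) : FreeAlgebra K (Fin n) :=
  (l.map (FreeAlgebra.ι K)).prod

lemma word_append (l l' : List (Fin n)) : word K (l ++ l') = word K l * word K l' := by
  simp [word]

lemma basisFreeMonoid_ofList (l : List (Fin n)) :
    FreeAlgebra.basisFreeMonoid K (Fin n) (FreeMonoid.ofList l) = word K l := by
  have h : FreeAlgebra.equivMonoidAlgebraFreeMonoid (word K l) =
      MonoidAlgebra.single (FreeMonoid.ofList l) (1 : K) := by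
    induction l with
    | nil => simp [word, MonoidAlgebra.one_def]
    | cons a l ih =>
      rw [← List.singleton_append, word_append, map_mul, ih, FreeMonoid.ofList_append]
      simp [word, FreeAlgebra.equivMonoidAlgebraFreeMonoid, MonoidAlgebra.single_mul_single]
  simp only [FreeAlgebra.basisFreeMonoid, Basis.map_apply, Finsupp.coe_basisSingleOne]
  rw [LinearEquiv.symm_apply_eq]
  ext
  simp [h]

/-- The vector of the coefficients of the words of length `q` in an element of the free algebra. -/
noncomputable def coords (K : Type*) [Field K] (n q : ℕ) :
    FreeAlgebra K (Fin n) →ₗ[K] ((Fin q → Fin n) → K) :=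
  LinearMap.pi fun w =>
    (FreeAlgebra.basisFreeMonoid K (Fin n)).coord (FreeMonoid.ofList (List.ofFn w))

lemma coords_word (q : ℕ) (l : List (Fin n)) (w : Fin q → Fin n) :
    coords K n q (word K l) w = if l = List.ofFn w then 1 else 0 := by
  rw [coords, LinearMap.pi_apply, ← basisFreeMonoid_ofList, Basis.coord_apply, Basis.repr_self,
    Finsupp.single_apply_left FreeMonoid.ofList.injective, Finsupp.single_apply]

/-- The element of the free algebra, homogeneous of degree `q`, with prescribed coefficients. -/
noncomputable def ofCoords (K : Type*) [Field K] (n q : ℕ) :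
    ((Fin q → Fin n) → K) →ₗ[K] FreeAlgebra K (Fin n) :=
  Fintype.linearCombination K fun w => word K (List.ofFn w)

lemma coords_ofCoords (q : ℕ) (f : (Fin q → Fin n) → K) : coords K n q (ofCoords K n q f) = f := by
  ext w
  simp [ofCoords, Fintype.linearCombination_apply, coords_word, List.ofFn_injective.eq_iff]

lemma range_ofCoords (q : ℕ) : LinearMap.range (ofCoords K n q) = freeComponent K n q := by
  rw [ofCoords, Fintype.range_linearCombination, freeComponent]
  simp [word, List.map_ofFn, Function.comp_def]

/-- `ofCoords ∘ coords` is the projection to the homogeneous component of degree `q`. -/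
lemma ofCoords_coords_word (q : ℕ) (l : List (Fin n)) :
    ofCoords K n q (coords K n q (word K l)) = if l.length = q then word K l else 0 := by
  rw [ofCoords, Fintype.linearCombination_apply]
  simp only [coords_word, ite_smul, one_smul, zero_smul]
  split_ifs with h
  · subst h
    rw [Finset.sum_eq_single l.get]
    · simp
    · intro w _ hw
      rw [if_neg]
      intro h
      apply hw
      apply List.ofFn_injective
      simpa using h.symm
    · simp
  · refine Finset.sum_eq_zero fun w _ => if_neg ?_
    rintro rfl
    simp at h

lemma span_range_word : Submodule.span K (Set.range (word K (n := n))) = ⊤ := by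
  rw [← (FreeAlgebra.basisFreeMonoid K (Fin n)).span_eq]
  congr 1
  ext x
  simp only [Set.mem_range]
  constructor
  · rintro ⟨l, rfl⟩
    exact ⟨_, basisFreeMonoid_ofList l⟩
  · rintro ⟨l, rfl⟩
    exact ⟨l.toList, (basisFreeMonoid_ofList _).symm⟩

/-! ### The homogeneous components of the ideal of relations -/

lemma word_mul_relation_mul_word (c : Coeffs K n d) (u v : List (Fin n)) (j : Fin d) :
    word K u * relation c j * word K v =
      ∑ k : Fin n, ∑ m : Fin n, c (j, k, m) • word K (u ++ [k, m] ++ v) := by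
  simp [relation, word, Finset.mul_sum, Finset.sum_mul, mul_assoc]

/-- The coordinates of the degree `q` component of the ideal of relations. -/
noncomputable def relCoords (c : Coeffs K n d) (q : ℕ) : Submodule K ((Fin q → Fin n) → K) :=
  Submodule.span K (Set.range fun p : List (Fin n) × Fin d × List (Fin n) =>
    coords K n q (word K p.1 * relation c p.2.1 * word K p.2.2))

/-- The ideal of relations is homogeneous: the degree `q` part of any of its elements is a combination
of the products of degree `q` of a relation with words. -/
lemma coords_mem_relCoords (c : Coeffs K n d) (q : ℕ) {x : FreeAlgebra K (Fin n)}
    (hx : x ∈ relIdeal c) : coords K n q x ∈ relCoords c q := by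
  rw [relIdeal, TwoSidedIdeal.mem_span_iff_mem_addSubgroup_closure] at hx
  induction hx using AddSubgroup.closure_induction with
  | mem x hx =>
    obtain ⟨y, ⟨a, -, _, ⟨j, rfl⟩, rfl⟩, b, -, rfl⟩ := hx
    have ha : a ∈ Submodule.span K (Set.range (word K (n := n))) := by simp [span_range_word]
    have hb : b ∈ Submodule.span K (Set.range (word K (n := n))) := by simp [span_range_word]
    change coords K n q (a * relation c j * b) ∈ _
    induction ha using Submodule.span_induction with
    | mem a ha =>
      obtain ⟨u, rfl⟩ := ha
      induction hb using Submodule.span_induction with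
      | mem b hb =>
        obtain ⟨v, rfl⟩ := hb
        exact Submodule.subset_span ⟨(u, j, v), rfl⟩
      | zero => simp
      | add x y _ _ hx hy => rw [mul_add, map_add]; exact add_mem hx hy
      | smul t x _ hx => rw [mul_smul_comm, map_smul]; exact Submodule.smul_mem _ _ hx
    | zero => simp
    | add x y _ _ hx hy => rw [add_mul, add_mul, map_add]; exact add_mem hx hy
    | smul t x _ hx =>
      rw [smul_mul_assoc, smul_mul_assoc, map_smul]; exact Submodule.smul_mem _ _ hx
  | zero => simp
  | add x y _ _ hx hy => rw [map_add]; exact add_mem hx hy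
  | neg x _ hx => rw [map_neg]; exact neg_mem hx

lemma mkₐ_eq_zero_iff (c : Coeffs K n d) (x : FreeAlgebra K (Fin n)) :
    (relIdeal c).ringCon.mkₐ K x = 0 ↔ x ∈ relIdeal c := by
  rw [TwoSidedIdeal.mem_iff, ← map_zero ((relIdeal c).ringCon.mkₐ K)]
  exact RingCon.eq _

lemma mkₐ_relation (c : Coeffs K n d) (j : Fin d) :
    (relIdeal c).ringCon.mkₐ K (relation c j) = 0 :=
  (mkₐ_eq_zero_iff c _).2 (TwoSidedIdeal.subset_span ⟨j, rfl⟩)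

lemma ofCoords_coords_mul_relation_mul (c : Coeffs K n d) (q : ℕ) (u v : List (Fin n))
    (j : Fin d) :
    ofCoords K n q (coords K n q (word K u * relation c j * word K v)) =
      if u.length + v.length + 2 = q then word K u * relation c j * word K v else 0 := by
  rw [word_mul_relation_mul_word]
  simp only [map_sum, map_smul, ofCoords_coords_word]
  have : ∀ k m : Fin n, ((u ++ [k, m] ++ v).length = q) = (u.length + v.length + 2 = q) := by
    intro k m
    simp only [List.length_append, List.length_cons, List.length_nil, eq_iff_iff]
    omega
  simp only [this]
  split_ifs <;> simp

lemma ker_mkₐ_comp_ofCoords (c : Coeffs K n d) (q : ℕ) :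
    LinearMap.ker (((relIdeal c).ringCon.mkₐ K).toLinearMap ∘ₗ ofCoords K n q) =
      relCoords c q := by
  apply le_antisymm
  · intro f hf
    rw [LinearMap.mem_ker, LinearMap.comp_apply, AlgHom.toLinearMap_apply, mkₐ_eq_zero_iff] at hf
    simpa [coords_ofCoords] using coords_mem_relCoords c q hf
  · rw [relCoords, Submodule.span_le]
    rintro _ ⟨⟨u, j, v⟩, rfl⟩
    simp only [SetLike.mem_coe, LinearMap.mem_ker, LinearMap.comp_apply,
      ofCoords_coords_mul_relation_mul]
    split_ifs
    · simp only [AlgHom.toLinearMap_apply, map_mul, mkₐ_relation, mul_zero, zero_mul]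
    · simp

/-- The dimension of a homogeneous component is the codimension of the relations in that degree. -/
theorem componentDim_add_finrank (c : Coeffs K n d) (q : ℕ) :
    componentDim c q + finrank K (relCoords c q) = n ^ q := by
  have h := LinearMap.finrank_range_add_finrank_ker
    (((relIdeal c).ringCon.mkₐ K).toLinearMap ∘ₗ ofCoords K n q)
  rw [ker_mkₐ_comp_ofCoords, LinearMap.range_comp, range_ofCoords] at h
  rw [Module.finrank_fintype_fun_eq_card, Fintype.card_fun, Fintype.card_fin, Fintype.card_fin] at h
  exact h

/-! ### Hilbert function in low degrees -/

lemma coords_mul_relation_mul_of_length_ne (c : Coeffs K n d) {q : ℕ} {u v : List (Fin n)}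
    (j : Fin d) (h : u.length + v.length + 2 ≠ q) :
    coords K n q (word K u * relation c j * word K v) = 0 := by
  rw [← coords_ofCoords q (coords K n q _), ofCoords_coords_mul_relation_mul, if_neg h, map_zero]

lemma relCoords_of_lt_two (c : Coeffs K n d) {q : ℕ} (hq : q < 2) : relCoords c q = ⊥ := by
  rw [relCoords, Submodule.span_eq_bot]
  rintro _ ⟨⟨u, j, v⟩, rfl⟩
  exact coords_mul_relation_mul_of_length_ne c j (by omega)

lemma componentDim_of_lt_two (c : Coeffs K n d) {q : ℕ} (hq : q < 2) :
    componentDim c q = n ^ q := by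
  have := componentDim_add_finrank c q
  rwa [relCoords_of_lt_two c hq, finrank_bot, add_zero] at this

lemma relCoords_two (c : Coeffs K n d) :
    relCoords c 2 = Submodule.span K (Set.range fun j => coords K n 2 (relation c j)) := by
  apply le_antisymm
  · rw [relCoords, Submodule.span_le]
    rintro _ ⟨⟨u, j, v⟩, rfl⟩
    by_cases h : u.length + v.length + 2 = 2
    · obtain rfl : u = [] := List.length_eq_zero_iff.1 (by omega)
      obtain rfl : v = [] := List.length_eq_zero_iff.1 (by omega)
      exact Submodule.subset_span ⟨j, by simp [word]⟩
    · simp only [coords_mul_relation_mul_of_length_ne c j h]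
      exact zero_mem _
  · rw [Submodule.span_le]
    rintro _ ⟨j, rfl⟩
    exact Submodule.subset_span ⟨([], j, []), by simp [word]⟩

lemma linearIndependent_coords_relation (c : Coeffs K n d) :
    (LinearIndependent K fun j => coords K n 2 (relation c j)) ↔
      LinearIndependent K (relation c) := by
  refine ⟨fun h => LinearIndependent.of_comp (coords K n 2) h, fun h => ?_⟩
  apply LinearIndependent.of_comp (ofCoords K n 2)
  convert h using 1
  ext1 j
  simpa [word] using ofCoords_coords_mul_relation_mul c 2 [] [] j

lemma componentDim_two (c : Coeffs K n d) (h : LinearIndependent K (relation c)) :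
    (componentDim c 2 : ℤ) = (n : ℤ) ^ 2 - d := by
  have h1 := componentDim_add_finrank c 2
  rw [relCoords_two, finrank_span_eq_card ((linearIndependent_coords_relation c).2 h),
    Fintype.card_fin] at h1
  have : ((componentDim c 2 + d : ℕ) : ℤ) = (n ^ 2 : ℕ) := by rw [h1]
  push_cast at this
  linarith

lemma linearIndependent_of_componentDim_two_le (c : Coeffs K n d)
    (h : (componentDim c 2 : ℤ) ≤ (n : ℤ) ^ 2 - d) : LinearIndependent K (relation c) := by
  rw [← linearIndependent_coords_relation, linearIndependent_iff_card_le_finrank_span,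
    Set.finrank, ← relCoords_two, Fintype.card_fin]
  have h1 := componentDim_add_finrank c 2
  have : ((componentDim c 2 + finrank K (relCoords c 2) : ℕ) : ℤ) = (n ^ 2 : ℕ) := by rw [h1]
  push_cast at this
  omega

lemma relCoords_three (c : Coeffs K n d) :
    relCoords c 3 = Submodule.span K (Set.range (Sum.elim
      (fun p : Fin n × Fin d => coords K n 3 (FreeAlgebra.ι K p.1 * relation c p.2))
      (fun p : Fin n × Fin d => coords K n 3 (relation c p.2 * FreeAlgebra.ι K p.1)))) := by
  apply le_antisymm
  · rw [relCoords, Submodule.span_le]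
    rintro _ ⟨⟨u, j, v⟩, rfl⟩
    by_cases h : u.length + v.length + 2 = 3
    · obtain ⟨hu, hv⟩ | ⟨hu, hv⟩ : (u.length = 0 ∧ v.length = 1) ∨
          (u.length = 1 ∧ v.length = 0) := by omega
      · obtain rfl := List.length_eq_zero_iff.1 hu
        obtain ⟨i, rfl⟩ := List.length_eq_one_iff.1 hv
        exact Submodule.subset_span ⟨Sum.inr (i, j), by simp [word]⟩
      · obtain rfl := List.length_eq_zero_iff.1 hv
        obtain ⟨i, rfl⟩ := List.length_eq_one_iff.1 hu
        exact Submodule.subset_span ⟨Sum.inl (i, j), by simp [word]⟩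
    · simp only [coords_mul_relation_mul_of_length_ne c j h]
      exact zero_mem _
  · rw [Submodule.span_le]
    rintro _ ⟨⟨i, j⟩ | ⟨i, j⟩, rfl⟩
    · exact Submodule.subset_span ⟨([i], j, []), by simp [word]⟩
    · exact Submodule.subset_span ⟨([], j, [i]), by simp [word]⟩

/-- The Golod–Shafarevich bound in degree three. -/
lemma le_componentDim_three (c : Coeffs K n d) :
    (n : ℤ) ^ 3 - 2 * n * d ≤ componentDim c 3 := by
  have h1 := componentDim_add_finrank c 3
  have h2 : finrank K (relCoords c 3) ≤ 2 * n * d := by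
    rw [relCoords_three]
    refine (finrank_range_le_card _).trans (le_of_eq ?_)
    simp
    ring
  have : ((componentDim c 3 + finrank K (relCoords c 3) : ℕ) : ℤ) = (n ^ 3 : ℕ) := by rw [h1]
  push_cast at this
  zify at h2
  linarith

lemma mkₐ_word_eq_zero (c : Coeffs K n d) {q : ℕ} (h : componentDim c q = 0)
    {l : List (Fin n)} (hl : q ≤ l.length) : (relIdeal c).ringCon.mkₐ K (word K l) = 0 := by
  have hr : relCoords c q = ⊤ := by
    apply Submodule.eq_top_of_finrank_eq
    have := componentDim_add_finrank c q
    simpa [h] using this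
  have h0 := ker_mkₐ_comp_ofCoords c q
  rw [hr, LinearMap.ker_eq_top] at h0
  rw [← List.take_append_drop q l, word_append, map_mul]
  have h1 := ofCoords_coords_word (K := K) q (l.take q)
  rw [if_pos (by simpa using hl)] at h1
  have h2 := LinearMap.congr_fun h0 (coords K n q (word K (l.take q)))
  rw [LinearMap.comp_apply, h1, AlgHom.toLinearMap_apply, LinearMap.zero_apply] at h2
  rw [h2, zero_mul]

lemma componentDim_eq_zero_of_word (c : Coeffs K n d) {q : ℕ}
    (h : ∀ l : List (Fin n), l.length = q → (relIdeal c).ringCon.mkₐ K (word K l) = 0) :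
    componentDim c q = 0 := by
  have : component c q = ⊥ := by
    rw [component, freeComponent, Submodule.map_span, Submodule.span_eq_bot]
    rintro _ ⟨_, ⟨w, rfl⟩, rfl⟩
    have := h (List.ofFn w) (by simp)
    simpa [word, List.map_ofFn, Function.comp_def] using! this
  rw [componentDim, this]
  exact finrank_bot K _

lemma componentDim_eq_zero_of_le (c : Coeffs K n d) {p q : ℕ} (hpq : p ≤ q)
    (h : componentDim c p = 0) : componentDim c q = 0 :=
  componentDim_eq_zero_of_word c fun _ hl => mkₐ_word_eq_zero c h (hl ▸ hpq)

/-! ### Semicontinuity of the Hilbert function -/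

/-- Having rank at least `r` is an open condition on a family of vectors which depends
polynomially on parameters. -/
lemma exists_polynomial_finrank_span_le {σ ι κ : Type*} [Finite κ]
    (p : ι → κ → MvPolynomial σ K) (c₀ : σ → K) :
    ∃ P : MvPolynomial σ K, MvPolynomial.eval c₀ P ≠ 0 ∧ ∀ c, MvPolynomial.eval c P ≠ 0 →
      finrank K (Submodule.span K (Set.range fun i k => MvPolynomial.eval c₀ (p i k))) ≤
        finrank K (Submodule.span K (Set.range fun i k => MvPolynomial.eval c (p i k))) := by
  classical
  have := Fintype.ofFinite κ
  set v : (σ → K) → ι → κ → K := fun c i k => MvPolynomial.eval c (p i k) with hv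
  obtain ⟨f, hf, -, hli⟩ := Submodule.exists_fun_fin_finrank_span_eq K (Set.range (v c₀))
  choose s hs using hf
  obtain ⟨L, hL⟩ := (Fintype.linearCombination K f).exists_leftInverse_of_injective
    (LinearMap.ker_eq_bot.2 hli.fintypeLinearCombination_injective)
  -- `L` maps the chosen basis vectors at `c₀` to the standard basis; the polynomial is the
  -- determinant of the images under `L` of the same members of the family.
  have hLf : ∀ j, L (f j) = Pi.single j 1 := fun j => by
    simpa [Fintype.linearCombination_apply_single] using
      LinearMap.congr_fun hL (Pi.single j (1 : K))
  let N : Matrix (Fin (finrank K (Submodule.span K (Set.range (v c₀)))))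
      (Fin (finrank K (Submodule.span K (Set.range (v c₀))))) (MvPolynomial σ K) :=
    Matrix.of fun j i => ∑ k, p (s j) k * MvPolynomial.C (L (Pi.single k 1) i)
  have hN : ∀ c, MvPolynomial.eval c N.det = (Matrix.of fun j => L (v c (s j))).det := fun c => by
    rw [RingHom.map_det]
    congr 1
    ext j i
    conv_rhs => rw [Matrix.of_apply, LinearMap.pi_apply_eq_sum_univ L]
    have hsingle : ∀ x : κ, (Pi.single x 1 : κ → K) = fun j => if x = j then 1 else 0 := fun x => by
      ext j
      simp [Pi.single_apply, eq_comm]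
    simp [N, hv, Finset.sum_apply, hsingle]
  refine ⟨N.det, ?_, fun c hc => ?_⟩
  · rw [hN]
    have : (Matrix.of fun j => L (v c₀ (s j))) = 1 := by
      ext j i
      rw [Matrix.of_apply, hs, hLf, Matrix.one_apply, Pi.single_apply]
      simp [eq_comm]
    simp [this]
  · rw [hN] at hc
    have h1 : LinearIndependent K fun j => v c (s j) :=
      LinearIndependent.of_comp L (Matrix.linearIndependent_rows_of_det_ne_zero hc)
    have h2 := finrank_span_eq_card h1
    rw [Fintype.card_fin] at h2
    rw [← h2]
    apply Submodule.finrank_mono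
    apply Submodule.span_mono
    rintro _ ⟨j, rfl⟩
    exact ⟨s j, rfl⟩

/-- Upper semicontinuity of the Hilbert function. -/
lemma exists_polynomial_componentDim_le (c₀ : Coeffs K n d) (q : ℕ) :
    ∃ P : MvPolynomial (Fin d × Fin n × Fin n) K, MvPolynomial.eval c₀ P ≠ 0 ∧
      ∀ c : Coeffs K n d, MvPolynomial.eval c P ≠ 0 → componentDim c q ≤ componentDim c₀ q := by
  classical
  obtain ⟨P, hP₀, hP⟩ := exists_polynomial_finrank_span_le (K := K) (κ := Fin q → Fin n)
    (fun (i : List (Fin n) × Fin d × List (Fin n)) w => ∑ k : Fin n, ∑ m : Fin n,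
      (MvPolynomial.X (i.2.1, k, m) : MvPolynomial (Fin d × Fin n × Fin n) K) *
        if i.1 ++ [k, m] ++ i.2.2 = List.ofFn w then 1 else 0) c₀
  have key : ∀ c : Coeffs K n d, relCoords c q = Submodule.span K (Set.range
      fun (i : List (Fin n) × Fin d × List (Fin n)) (w : Fin q → Fin n) =>
        MvPolynomial.eval c (∑ k : Fin n, ∑ m : Fin n,
      (MvPolynomial.X (i.2.1, k, m) : MvPolynomial (Fin d × Fin n × Fin n) K) *
        if i.1 ++ [k, m] ++ i.2.2 = List.ofFn w then 1 else 0)) := fun c => by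
    rw [relCoords]
    congr 2
    ext i w
    rw [word_mul_relation_mul_word]
    simp only [map_sum, map_smul, Finset.sum_apply, Pi.smul_apply, coords_word, smul_eq_mul,
      map_mul, MvPolynomial.eval_X]
    refine Finset.sum_congr rfl fun k _ => Finset.sum_congr rfl fun m _ => ?_
    split_ifs <;> simp
  refine ⟨P, hP₀, fun c hc => ?_⟩
  have h := hP c hc
  rw [← key, ← key] at h
  have h1 := componentDim_add_finrank c q
  have h2 := componentDim_add_finrank c₀ q
  omega

/-! ### Dense open sets of the Zariski topology -/

lemma isOpen_zariski_setOf_eval_ne_zero {σ : Type*} (P : MvPolynomial σ K) :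
    @IsOpen _ (zariski K σ) {c | MvPolynomial.eval c P ≠ 0} := by
  change ∃ S : Set (MvPolynomial σ K), _
  exact ⟨{P}, by ext; simp⟩

lemma exists_eval_ne_zero [Infinite K] {σ : Type*} {P : MvPolynomial σ K} (hP : P ≠ 0) :
    ∃ c, MvPolynomial.eval c P ≠ 0 := by
  by_contra! h
  exact hP (MvPolynomial.funext fun c => by simp [h c])

lemma dense_zariski_setOf_eval_ne_zero [Infinite K] {σ : Type*} {P : MvPolynomial σ K}
    (hP : P ≠ 0) : @Dense _ (zariski K σ) {c | MvPolynomial.eval c P ≠ 0} := by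
  let := zariski K σ
  rw [dense_iff_inter_open]
  rintro V ⟨S, hS⟩ ⟨x, hx⟩
  have : ∃ p ∈ S, MvPolynomial.eval x p ≠ 0 := by
    by_contra! h
    have hx' : x ∈ Vᶜ := by rw [hS]; exact h
    exact hx' hx
  obtain ⟨p, hp, hpx⟩ := this
  have hp0 : p ≠ 0 := by rintro rfl; simp at hpx
  obtain ⟨c, hc⟩ := exists_eval_ne_zero (mul_ne_zero hp0 hP)
  rw [map_mul, mul_ne_zero_iff] at hc
  refine ⟨c, ?_, hc.2⟩
  by_contra hcV
  have : c ∈ Vᶜ := hcV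
  rw [hS] at this
  exact hc.1 (this p hp)

/-! ### The Golod–Shafarevich series -/

/-- The coefficients of `(1 - n t + d t²)⁻¹`, given by their linear recurrence. -/
def gsCoeff (n d : ℕ) : ℕ → ℤ
  | 0 => 1
  | 1 => n
  | q + 2 => n * gsCoeff n d (q + 1) - d * gsCoeff n d q

lemma coeff_invOfUnit_eq_gsCoeff (n d q : ℕ) :
    PowerSeries.coeff q (PowerSeries.invOfUnit
      (1 - (n : PowerSeries ℤ) * PowerSeries.X + (d : PowerSeries ℤ) * PowerSeries.X ^ 2) 1) =
      gsCoeff n d q := by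
  have h1 : (1 - (n : PowerSeries ℤ) * PowerSeries.X + (d : PowerSeries ℤ) * PowerSeries.X ^ 2) *
      PowerSeries.mk (gsCoeff n d) = 1 := by
    have hn : (n : PowerSeries ℤ) = PowerSeries.C (n : ℤ) := by simp
    have hd : (d : PowerSeries ℤ) = PowerSeries.C (d : ℤ) := by simp
    ext q
    rw [hn, hd, add_mul, sub_mul, one_mul, mul_assoc, mul_assoc, pow_two, mul_assoc, map_add,
      map_sub, PowerSeries.coeff_C_mul, PowerSeries.coeff_C_mul]
    match q with
    | 0 => simp [gsCoeff]
    | 1 => simp [gsCoeff, PowerSeries.coeff_succ_X_mul, PowerSeries.coeff_one]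
    | q + 2 =>
      rw [PowerSeries.coeff_succ_X_mul, PowerSeries.coeff_succ_X_mul,
        PowerSeries.coeff_succ_X_mul]
      simp [gsCoeff, PowerSeries.coeff_one]
  have h2 := PowerSeries.mul_invOfUnit
    (1 - (n : PowerSeries ℤ) * PowerSeries.X + (d : PowerSeries ℤ) * PowerSeries.X ^ 2) 1
    (by simp)
  rw [mul_comm] at h1
  rw [← left_inv_eq_right_inv h1 h2, PowerSeries.coeff_mk]

lemma le_of_rat_le (h : 4 * ((n : ℚ) ^ 2 + n) / 9 ≤ d) : 4 * (n ^ 2 + n) ≤ 9 * d := by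
  rw [div_le_iff₀ (by norm_num)] at h
  have : ((4 * (n ^ 2 + n) : ℕ) : ℚ) ≤ (9 * d : ℕ) := by push_cast; linarith
  exact_mod_cast this

lemma gsCoeff_three : gsCoeff n d 3 = (n : ℤ) ^ 3 - 2 * n * d := by
  simp only [gsCoeff]
  ring

/-- The quadratic `(d - 4 n² / 9) (n² / 2 - d) ≥ 0` bounds `d²` by a linear function of `d`, for which
the claim is clear at both ends of the range. -/
lemma gsCoeff_four_neg (hn : 0 < n) (h : 4 * (n ^ 2 + n) ≤ 9 * d) (h2 : 2 * d ≤ n ^ 2) :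
    gsCoeff n d 4 < 0 := by
  have h0 : gsCoeff n d 4 = (n : ℤ) ^ 4 - 3 * n ^ 2 * d + d ^ 2 := by
    simp only [gsCoeff]
    ring
  rw [h0]
  zify at hn h h2
  nlinarith [mul_nonneg (sub_nonneg.2 h2) (sub_nonneg.2 h), pow_pos hn 3, pow_pos hn 4]

/-- In the range under consideration the series vanishes from degree four on: it is truncated in degree
three or four if `n > 0`, and it is `1` if `n = 0`. -/
lemma coeff_golodShafarevich (hd : d ≤ n ^ 2) (h : 4 * (n ^ 2 + n) ≤ 9 * d) (q : ℕ) :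
    PowerSeries.coeff q (golodShafarevich n d) = match q with
      | 0 => 1
      | 1 => (n : ℤ)
      | 2 => (n : ℤ) ^ 2 - d
      | 3 => max 0 ((n : ℤ) ^ 3 - 2 * n * d)
      | _ + 4 => 0 := by
  have h2 : gsCoeff n d 2 = (n : ℤ) ^ 2 - d := by
    simp only [gsCoeff]
    ring
  have h0 : ∀ j < 3, 0 ≤ gsCoeff n d j := by
    intro j hj
    interval_cases j
    · simp [gsCoeff]
    · simp [gsCoeff]
    · rw [h2]
      zify at hd
      linarith
  have hlow : ∀ q < 3, ¬ ∃ j ≤ q, gsCoeff n d j < 0 := by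
    rintro q hq ⟨j, hj, hneg⟩
    exact absurd (h0 j (by omega)) (by omega)
  simp only [golodShafarevich, truncAtNeg, PowerSeries.coeff_mk, coeff_invOfUnit_eq_gsCoeff]
  match q with
  | 0 => rw [if_neg (hlow 0 (by norm_num))]; rfl
  | 1 => rw [if_neg (hlow 1 (by norm_num))]; rfl
  | 2 => rw [if_neg (hlow 2 (by norm_num)), h2]
  | 3 =>
    rw [← gsCoeff_three]
    split_ifs with hj
    · obtain ⟨j, hj, hneg⟩ := hj
      have : j = 3 := by
        by_contra hne
        exact absurd (h0 j (by omega)) (by omega)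
      subst this
      exact (max_eq_left hneg.le).symm
    · push Not at hj
      exact (max_eq_right (hj 3 le_rfl)).symm
  | q + 4 =>
    rw [ite_eq_left_iff]
    intro hj
    push Not at hj
    rcases Nat.eq_zero_or_pos n with rfl | hn
    · obtain rfl : d = 0 := by omega
      simp [gsCoeff]
    · have h3 := hj 3 (by omega)
      have h4 := hj 4 (by omega)
      rw [gsCoeff_three] at h3
      refine absurd (gsCoeff_four_neg hn h ?_) (not_lt.2 h4)
      zify at hn ⊢
      nlinarith

lemma golodShafarevich_eq (hd : d ≤ n ^ 2) (h : 4 * (n ^ 2 + n) ≤ 9 * d) :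
    golodShafarevich n d =
        1 + PowerSeries.C (n : ℤ) * PowerSeries.X
          + PowerSeries.C ((n : ℤ) ^ 2 - d) * PowerSeries.X ^ 2
          + PowerSeries.C (max 0 ((n : ℤ) ^ 3 - 2 * n * d)) * PowerSeries.X ^ 3 := by
  ext q
  rw [coeff_golodShafarevich hd h]
  simp only [map_add, PowerSeries.coeff_C_mul, PowerSeries.coeff_X_pow, PowerSeries.coeff_X,
    PowerSeries.coeff_one]
  match q with
  | 0 => simp
  | 1 => simp
  | 2 => simp
  | 3 => simp
  | q + 4 => simp

/-! ### Nilpotent algebras with few relations -/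

/-- The coefficient vector of the quadratic monomial `x y`. -/
def quadMonomial (K : Type*) [Field K] {X : Type*} [DecidableEq X] (x y : X) : X × X → K :=
  Pi.single (x, y) 1

lemma sum_quadMonomial_smul {X Q : Type*} [DecidableEq X] [Fintype X] [AddCommGroup Q] [Module K Q]
    (x y : X) (f : X × X → Q) : ∑ p, quadMonomial K x y p • f p = f (x, y) := by
  simp [quadMonomial, Pi.single_apply, ite_smul]

/-- At most `d` quadratic relations on an arbitrary set of `n` letters are imposed by some point of
the coefficient space; the missing relations are taken to be zero. -/
lemma exists_coeffs {X J : Type*} [Fintype X] [Fintype J] (ρ : J → X × X → K)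
    (hX : Fintype.card X = n) (hJ : Fintype.card J ≤ d) :
    ∃ (c : Coeffs K n d) (y : X → QuadraticAlg c),
      (∀ i, ∃ x, (relIdeal c).ringCon.mkₐ K (FreeAlgebra.ι K i) = y x) ∧
      ∀ j, ∑ p : X × X, ρ j p • (y p.1 * y p.2) = 0 := by
  obtain ⟨e⟩ : Nonempty (X ≃ Fin n) := ⟨Fintype.equivFinOfCardEq hX⟩
  obtain ⟨f⟩ : Nonempty (J ↪ Fin d) := Function.Embedding.nonempty_of_card_le (by simpa using hJ)
  let c : Coeffs K n d := fun p =>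
    Function.extend f ρ 0 p.1 (e.symm p.2.1, e.symm p.2.2)
  refine ⟨c, fun x => (relIdeal c).ringCon.mkₐ K (FreeAlgebra.ι K (e x)),
    fun i => ⟨e.symm i, by simp⟩, fun j => ?_⟩
  have h := mkₐ_relation c (f j)
  simp only [relation, map_sum, map_smul, map_mul, c, f.injective.extend_apply] at h
  rw [← h, Fintype.sum_prod_type, ← e.sum_comp]
  refine Finset.sum_congr rfl fun k _ => ?_
  rw [← e.sum_comp]
  simp

/-- Products of three generators vanish in the algebra with blocks `a`, `b` and extra letters `z`. All
words are brought to the form with `z` in front and `b b` in place of `a a`. -/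
lemma mul_mul_eq_zero_of_relations {Q α ζ : Type*} [Ring Q] (a b : α → Q) (z : ζ → Q)
    (hab : ∀ s t, a s * b t = 0) (haa : ∀ s t, a s * a t = b s * b t)
    (haz : ∀ s l, a s * z l = z l * a s + z l * b s) (hbz : ∀ s l, b s * z l = z l * b s)
    (hzz : ∀ l l', z l * z l' = 0) (u v w : α ⊕ α ⊕ ζ) :
    Sum.elim a (Sum.elim b z) u * (Sum.elim a (Sum.elim b z) v * Sum.elim a (Sum.elim b z) w)
      = 0 := by
  have hab' : ∀ s t x, a s * (b t * x) = 0 := fun s t x => by rw [← mul_assoc, hab, zero_mul]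
  have haa' : ∀ s t x, a s * (a t * x) = b s * (b t * x) := fun s t x => by
    rw [← mul_assoc, haa, mul_assoc]
  have haz' : ∀ s l x, a s * (z l * x) = z l * (a s * x) + z l * (b s * x) := fun s l x => by
    rw [← mul_assoc, haz, add_mul, mul_assoc, mul_assoc]
  have hbz' : ∀ s l x, b s * (z l * x) = z l * (b s * x) := fun s l x => by
    rw [← mul_assoc, hbz, mul_assoc]
  have hzz' : ∀ l l' x, z l * (z l' * x) = 0 := fun l l' x => by rw [← mul_assoc, hzz, zero_mul]
  have hbba : ∀ s t r, b s * (b t * a r) = 0 := fun s t r => by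
    rw [← haa', haa, hab']
  have hbbb : ∀ s t r, b s * (b t * b r) = 0 := fun s t r => by
    rw [← haa', hab, mul_zero]
  -- moving `z` to the left through the relation `a b = 0`
  have hzbb : ∀ l s t, z l * (b s * b t) = 0 := fun l s t => by
    have h : a s * (b t * z l) = 0 := by rw [hab']
    rwa [hbz, haz', hab, mul_zero, zero_add] at h
  -- moving `z` to the left through the relation `a a = b b`
  have hzba : ∀ l s t, z l * (b s * a t) = 0 := fun l s t => by
    have h : a s * (a t * z l) = b s * (b t * z l) := by rw [haa']
    simpa [haz, hbz, haz', hbz', haa, hab, mul_add, hzbb] using h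
  rcases u with s | s | s <;> rcases v with t | t | t <;> rcases w with r | r | r <;>
    simp [hab, haa, haz, hbz, hzz, hab', haz', hbz', hzz', hbba, hbbb, hzbb, hzba, mul_add]

/-- Products of four generators vanish in the algebra with blocks `a`, `b`, `c`: the rewriting rules
`a a → b c`, `b b → c c`, `a b → 0`, `a c → 0`, completed by `b c x → 0`, `c c b → 0`, `c c c a → 0`
and `c c c c → 0`, leave no normal words of length four. -/
lemma mul_mul_mul_eq_zero_of_relations {Q α : Type*} [Ring Q] (a b c : α → Q)
    (hab : ∀ s t, a s * b t = 0) (hac : ∀ s t, a s * c t = 0)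
    (haa : ∀ s t, a s * a t = b s * c t) (hbb : ∀ s t, b s * b t = c s * c t)
    (u v w x : α ⊕ α ⊕ α) :
    Sum.elim a (Sum.elim b c) u * (Sum.elim a (Sum.elim b c) v * (Sum.elim a (Sum.elim b c) w *
      Sum.elim a (Sum.elim b c) x)) = 0 := by
  have hab' : ∀ s t x, a s * (b t * x) = 0 := fun s t x => by rw [← mul_assoc, hab, zero_mul]
  have hac' : ∀ s t x, a s * (c t * x) = 0 := fun s t x => by rw [← mul_assoc, hac, zero_mul]
  have haa' : ∀ s t x, a s * (a t * x) = b s * (c t * x) := fun s t x => by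
    rw [← mul_assoc, haa, mul_assoc]
  have hbb' : ∀ s t x, b s * (b t * x) = c s * (c t * x) := fun s t x => by
    rw [← mul_assoc, hbb, mul_assoc]
  have hbca : ∀ s t r, b s * (c t * a r) = 0 := fun s t r => by rw [← haa', haa, hab']
  have hbcb : ∀ s t r, b s * (c t * b r) = 0 := fun s t r => by rw [← haa', hab, mul_zero]
  have hbcc : ∀ s t r, b s * (c t * c r) = 0 := fun s t r => by rw [← haa', hac, mul_zero]
  have hbcb' : ∀ s t r x, b s * (c t * (b r * x)) = 0 := fun s t r x => by
    rw [← mul_assoc (c t), ← mul_assoc, hbcb, zero_mul]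
  have hbcc' : ∀ s t r x, b s * (c t * (c r * x)) = 0 := fun s t r x => by
    rw [← mul_assoc (c t), ← mul_assoc, hbcc, zero_mul]
  have hccb : ∀ s t r, c s * (c t * b r) = 0 := fun s t r => by rw [← hbb', hbb, hbcc]
  have hccb' : ∀ s t r x, c s * (c t * (b r * x)) = 0 := fun s t r x => by
    rw [← mul_assoc (c t), ← mul_assoc, hccb, zero_mul]
  have hccca : ∀ s t r q, c s * (c t * (c r * a q)) = 0 := fun s t r q => by
    rw [← hbb', hbca, mul_zero]
  have hcccc : ∀ s t r q, c s * (c t * (c r * c q)) = 0 := fun s t r q => by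
    rw [← hbb', hbcc, mul_zero]
  rcases u with s | s | s <;> rcases v with t | t | t <;> rcases w with r | r | r <;>
    rcases x with q | q | q <;>
    simp only [Sum.elim_inl, Sum.elim_inr, hab, hac, haa, hbb, hab', hac', hbb', hbca, hbcb,
      hbcc, hbcb', hbcc', hccb, hccb', hccca, hcccc, mul_zero]

/-- With letters `z` that permute the blocks cyclically, already the products of three letters are
zero after left multiplication by `z`. -/
lemma mul_mul_mul_eq_zero_of_twisted_relations {Q α ζ : Type*} [Ring Q] (a b c : α → Q) (z : ζ → Q)
    (hab : ∀ s t, a s * b t = 0) (hac : ∀ s t, a s * c t = 0)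
    (haa : ∀ s t, a s * a t = b s * c t) (hbb : ∀ s t, b s * b t = c s * c t)
    (haz : ∀ s l, a s * z l = z l * b s) (hbz : ∀ s l, b s * z l = z l * c s)
    (hcz : ∀ s l, c s * z l = z l * a s) (l : ζ) (u v w : α ⊕ α ⊕ α) :
    z l * (Sum.elim a (Sum.elim b c) u * (Sum.elim a (Sum.elim b c) v *
      Sum.elim a (Sum.elim b c) w)) = 0 := by
  have haz' : ∀ s l x, a s * (z l * x) = z l * (b s * x) := fun s l x => by
    rw [← mul_assoc, haz, mul_assoc]
  have hbz' : ∀ s l x, b s * (z l * x) = z l * (c s * x) := fun s l x => by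
    rw [← mul_assoc, hbz, mul_assoc]
  have hcz' : ∀ s l x, c s * (z l * x) = z l * (a s * x) := fun s l x => by
    rw [← mul_assoc, hcz, mul_assoc]
  -- moving `z` to the left through each relation gives the relation with its letters permuted
  have hzbc : ∀ s t, z l * (b s * c t) = 0 := fun s t => by
    rw [← haz', ← hbz, ← mul_assoc, hab, zero_mul]
  have hzba : ∀ s t, z l * (b s * a t) = 0 := fun s t => by
    rw [← haz', ← hcz, ← mul_assoc, hac, zero_mul]
  have hzbb : ∀ s t, z l * (b s * b t) = z l * (c s * a t) := fun s t => by
    rw [← haz', ← haz, ← mul_assoc, haa, mul_assoc, hcz, hbz']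
  have hzcc : ∀ s t, z l * (c s * c t) = z l * (a s * a t) := fun s t => by
    rw [← hbz', ← hbz, ← mul_assoc, hbb, mul_assoc, hcz, hcz']
  have hzaa : ∀ s t, z l * (a s * a t) = 0 := fun s t => by rw [haa, hzbc]
  have hzca : ∀ s t, z l * (c s * a t) = 0 := fun s t => by rw [← hzbb, hbb, hzcc, hzaa]
  have assoc : ∀ x y w, z l * (x * y) = 0 → z l * (x * (y * w)) = 0 := fun x y w h => by
    rw [← mul_assoc x, ← mul_assoc, h, zero_mul]
  -- the only monomial of degree two not killed on the left by `z` is `c b`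
  have hzcba : ∀ s t r, z l * (c s * (b t * a r)) = 0 := fun s t r => by
    rw [← hbz', hzba, mul_zero]
  have hzcbb : ∀ s t r, z l * (c s * (b t * b r)) = 0 := fun s t r => by
    rw [hbb, assoc _ _ _ (by rw [hzcc, hzaa])]
  have hzcbc : ∀ s t r, z l * (c s * (b t * c r)) = 0 := fun s t r => by
    rw [← haa, assoc _ _ _ (hzca _ _)]
  rcases u with s | s | s <;> rcases v with t | t | t <;> rcases w with r | r | r <;>
    simp only [Sum.elim_inl, Sum.elim_inr] <;>
    first
    | exact hzcba _ _ _
    | exact hzcbb _ _ _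
    | exact hzcbc _ _ _
    | exact assoc _ _ _ (by simp only [hab, hac, hzbc, hzba, hzbb, hzcc, hzaa, hzca, mul_zero])

/-- Adjoining letters `z` with `v z = z φ(v)` and `z z = 0` keeps the fourth power zero as soon as
the words beginning with `z` vanish. -/
lemma mul_mul_mul_eq_zero_of_moves {Q X ζ : Type*} [Ring Q] (y : X → Q) (z : ζ → Q) (φ : X → X)
    (hy : ∀ u v w x, y u * (y v * (y w * y x)) = 0)
    (hz : ∀ l u v w, z l * (y u * (y v * y w)) = 0)
    (hyz : ∀ u l, y u * z l = z l * y (φ u)) (hzz : ∀ l l', z l * z l' = 0)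
    (u v w x : X ⊕ ζ) :
    Sum.elim y z u * (Sum.elim y z v * (Sum.elim y z w * Sum.elim y z x)) = 0 := by
  have hyz' : ∀ u l x, y u * (z l * x) = z l * (y (φ u) * x) := fun u l x => by
    rw [← mul_assoc, hyz, mul_assoc]
  have hzz' : ∀ l l' x, z l * (z l' * x) = 0 := fun l l' x => by rw [← mul_assoc, hzz, zero_mul]
  rcases u with u | u <;> rcases v with v | v <;> rcases w with w | w <;> rcases x with x | x <;>
    simp only [Sum.elim_inl, Sum.elim_inr, hy, hz, hyz, hzz, hyz', hzz', mul_zero]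

/-- From `⌈n² / 2⌉` relations on, the degree three component can be made zero. The construction uses
`2 k² + 2 k r + r²` relations for `n = 2 k + r` with `r < 2`. -/
lemma exists_componentDim_three_eq_zero (h : n ^ 2 ≤ 2 * d) :
    ∃ c : Coeffs K n d, componentDim c 3 = 0 := by
  obtain ⟨k, r, hr, rfl⟩ : ∃ k r, r < 2 ∧ n = 2 * k + r :=
    ⟨n / 2, n % 2, Nat.mod_lt _ (by norm_num), by omega⟩
  let A : Fin k → Fin k ⊕ Fin k ⊕ Fin r := Sum.inl
  let B : Fin k → Fin k ⊕ Fin k ⊕ Fin r := fun s => Sum.inr (Sum.inl s)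
  let Z : Fin r → Fin k ⊕ Fin k ⊕ Fin r := fun l => Sum.inr (Sum.inr l)
  let M := quadMonomial K (X := Fin k ⊕ Fin k ⊕ Fin r)
  obtain ⟨c, y, hy, hrel⟩ := exists_coeffs (n := 2 * k + r) (d := d)
    (J := (Fin k × Fin k) ⊕ (Fin k × Fin k) ⊕ (Fin k × Fin r) ⊕ (Fin k × Fin r) ⊕ (Fin r × Fin r))
    (Sum.elim (fun p => M (A p.1) (B p.2))
      (Sum.elim (fun p => M (A p.1) (A p.2) - M (B p.1) (B p.2))
      (Sum.elim (fun p => M (A p.1) (Z p.2) - (M (Z p.2) (A p.1) + M (Z p.2) (B p.1)))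
      (Sum.elim (fun p => M (B p.1) (Z p.2) - M (Z p.2) (B p.1))
      (fun p => M (Z p.1) (Z p.2))))))
    (by simp; ring)
    (by
      simp only [Fintype.card_sum, Fintype.card_prod, Fintype.card_fin]
      interval_cases r <;> ring_nf at h ⊢ <;> omega)
  simp only [Sum.forall, Prod.forall, Sum.elim_inl, Sum.elim_inr, Pi.sub_apply, Pi.add_apply,
    sub_smul, add_smul, Finset.sum_sub_distrib, Finset.sum_add_distrib, M, sum_quadMonomial_smul,
    sub_eq_zero] at hrel
  obtain ⟨hab, haa, haz, hbz, hzz⟩ := hrel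
  have hyelim : y = Sum.elim (fun s => y (A s)) (Sum.elim (fun s => y (B s)) fun l => y (Z l)) := by
    ext (s | s | s) <;> rfl
  refine ⟨c, componentDim_eq_zero_of_word c fun l hl => ?_⟩
  obtain ⟨i₁, i₂, i₃, rfl⟩ := List.length_eq_three.1 hl
  obtain ⟨x₁, h₁⟩ := hy i₁
  obtain ⟨x₂, h₂⟩ := hy i₂
  obtain ⟨x₃, h₃⟩ := hy i₃
  simp only [word, List.map_cons, List.map_nil, List.prod_cons, List.prod_nil, mul_one, map_mul,
    h₁, h₂, h₃]
  rw [hyelim]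
  exact mul_mul_eq_zero_of_relations _ _ _ hab haa haz hbz hzz _ _ _

/-- From `4 (n² + n) / 9` relations on, the degree four component can be made zero. The construction
uses `4 m² + 3 m r + r²` relations for `n = 3 m + r` with `r < 3`; for `n = 2`, `d = 3` this would be
one too many, but there `2 * d ≥ n ^ 2`. -/
lemma exists_componentDim_four_eq_zero (h : 4 * (n ^ 2 + n) ≤ 9 * d) (h' : 2 * d < n ^ 2) :
    ∃ c : Coeffs K n d, componentDim c 4 = 0 := by
  obtain ⟨m, r, hr, rfl⟩ : ∃ m r, r < 3 ∧ n = 3 * m + r :=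
    ⟨n / 3, n % 3, Nat.mod_lt _ (by norm_num), by omega⟩
  let A : Fin m → (Fin m ⊕ Fin m ⊕ Fin m) ⊕ Fin r := fun s => Sum.inl (Sum.inl s)
  let B : Fin m → (Fin m ⊕ Fin m ⊕ Fin m) ⊕ Fin r := fun s => Sum.inl (Sum.inr (Sum.inl s))
  let C : Fin m → (Fin m ⊕ Fin m ⊕ Fin m) ⊕ Fin r := fun s => Sum.inl (Sum.inr (Sum.inr s))
  let Z : Fin r → (Fin m ⊕ Fin m ⊕ Fin m) ⊕ Fin r := Sum.inr
  let M := quadMonomial K (X := (Fin m ⊕ Fin m ⊕ Fin m) ⊕ Fin r)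
  obtain ⟨c, y, hy, hrel⟩ := exists_coeffs (n := 3 * m + r) (d := d)
    (J := (Fin m × Fin m) ⊕ (Fin m × Fin m) ⊕ (Fin m × Fin m) ⊕ (Fin m × Fin m) ⊕
      (Fin m × Fin r) ⊕ (Fin m × Fin r) ⊕ (Fin m × Fin r) ⊕ (Fin r × Fin r))
    (Sum.elim (fun p => M (A p.1) (B p.2))
      (Sum.elim (fun p => M (A p.1) (C p.2))
      (Sum.elim (fun p => M (A p.1) (A p.2) - M (B p.1) (C p.2))
      (Sum.elim (fun p => M (B p.1) (B p.2) - M (C p.1) (C p.2))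
      (Sum.elim (fun p => M (A p.1) (Z p.2) - M (Z p.2) (B p.1))
      (Sum.elim (fun p => M (B p.1) (Z p.2) - M (Z p.2) (C p.1))
      (Sum.elim (fun p => M (C p.1) (Z p.2) - M (Z p.2) (A p.1))
      (fun p => M (Z p.1) (Z p.2)))))))))
    (by simp; ring)
    (by
      simp only [Fintype.card_sum, Fintype.card_prod, Fintype.card_fin]
      interval_cases r <;> ring_nf at h h' ⊢ <;> first | omega | skip
      rcases m with _ | m
      · omega
      · ring_nf at h ⊢
        omega)
  simp only [Sum.forall, Prod.forall, Sum.elim_inl, Sum.elim_inr, Pi.sub_apply,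
    sub_smul, Finset.sum_sub_distrib, M, sum_quadMonomial_smul, sub_eq_zero] at hrel
  obtain ⟨hab, hac, haa, hbb, haz, hbz, hcz, hzz⟩ := hrel
  let V : Fin m ⊕ Fin m ⊕ Fin m → QuadraticAlg c :=
    Sum.elim (fun s => y (A s)) (Sum.elim (fun s => y (B s)) fun s => y (C s))
  have hyelim : y = Sum.elim V fun l => y (Z l) := by
    ext ((s | s | s) | s) <;> rfl
  have hV := mul_mul_mul_eq_zero_of_moves V (fun l => y (Z l))
    -- the cyclic permutation `a ↦ b ↦ c ↦ a` of the blocks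
    (Sum.elim (fun s => Sum.inr (Sum.inl s))
      (Sum.elim (fun s => Sum.inr (Sum.inr s)) fun s => Sum.inl s))
    (mul_mul_mul_eq_zero_of_relations _ _ _ hab hac haa hbb)
    (mul_mul_mul_eq_zero_of_twisted_relations _ _ _ _ hab hac haa hbb haz hbz hcz)
    (by
      rintro (s | s | s) l
      · exact haz s l
      · exact hbz s l
      · exact hcz s l)
    hzz
  refine ⟨c, componentDim_eq_zero_of_word c fun l hl => ?_⟩
  obtain ⟨i₁, l, rfl⟩ := List.exists_cons_of_length_eq_add_one hl
  obtain ⟨i₂, i₃, i₄, rfl⟩ := List.length_eq_three.1 (by simpa using hl)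
  obtain ⟨x₁, h₁⟩ := hy i₁
  obtain ⟨x₂, h₂⟩ := hy i₂
  obtain ⟨x₃, h₃⟩ := hy i₃
  obtain ⟨x₄, h₄⟩ := hy i₄
  simp only [word, List.map_cons, List.map_nil, List.prod_cons, List.prod_nil, mul_one, map_mul,
    h₁, h₂, h₃, h₄]
  rw [hyelim]
  exact hV _ _ _ _

/-! ### Algebras with the minimal degree three component -/

lemma coords_three_word (i k m : Fin n) (w : Fin 3 → Fin n) :
    coords K n 3 (word K [i, k, m]) w = if ![i, k, m] = w then 1 else 0 := by
  have h : [i, k, m] = List.ofFn w ↔ ![i, k, m] = w := by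
    rw [← List.ofFn_injective.eq_iff]
    simp
  simp only [coords_word, h]

lemma ι_mul_relation (c : Coeffs K n d) (i : Fin n) (j : Fin d) :
    FreeAlgebra.ι K i * relation c j =
      ∑ k : Fin n, ∑ m : Fin n, c (j, k, m) • word K [i, k, m] := by
  simpa [word] using word_mul_relation_mul_word c [i] [] j

lemma relation_mul_ι (c : Coeffs K n d) (i : Fin n) (j : Fin d) :
    relation c j * FreeAlgebra.ι K i =
      ∑ k : Fin n, ∑ m : Fin n, c (j, k, m) • word K [k, m, i] := by
  simpa [word] using word_mul_relation_mul_word c [] [i] j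

lemma coords_ι_mul_relation (c : Coeffs K n d) (i : Fin n) (j : Fin d) (i' k' m' : Fin n) :
    coords K n 3 (FreeAlgebra.ι K i * relation c j) ![i', k', m'] =
      if i = i' then c (j, k', m') else 0 := by
  rw [ι_mul_relation]
  simp [coords_three_word, ite_and, Finset.sum_apply]

lemma coords_relation_mul_ι (c : Coeffs K n d) (i : Fin n) (j : Fin d) (i' k' m' : Fin n) :
    coords K n 3 (relation c j * FreeAlgebra.ι K i) ![i', k', m'] =
      if i = m' then c (j, i', k') else 0 := by
  rw [relation_mul_ι]
  simp [coords_three_word, ite_and, Finset.sum_apply]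

/-- If the relations `c'` leave nothing in degree three, no nonzero tensor of order three is
orthogonal to them both in its last two and in its first two indices. -/
lemma eq_zero_of_orthogonal (c : Coeffs K n d) (hc : componentDim c 3 = 0)
    (T : Fin n → Fin n → Fin n → K)
    (hr : ∀ i j, ∑ k, ∑ m, c (j, k, m) * T i k m = 0)
    (hl : ∀ i j, ∑ k, ∑ m, c (j, k, m) * T k m i = 0) (i k m : Fin n) : T i k m = 0 := by
  have htop : relCoords c 3 = ⊤ := by
    apply Submodule.eq_top_of_finrank_eq
    have := componentDim_add_finrank c 3
    simpa [hc] using this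
  let τ : ((Fin 3 → Fin n) → K) →ₗ[K] K :=
    Fintype.linearCombination K fun w => T (w 0) (w 1) (w 2)
  have hτ : ∀ i k m, τ (coords K n 3 (word K [i, k, m])) = T i k m := fun i k m => by
    simp [τ, Fintype.linearCombination_apply, coords_three_word]
  have hle : relCoords c 3 ≤ LinearMap.ker τ := by
    rw [relCoords_three, Submodule.span_le]
    rintro _ ⟨⟨i, j⟩ | ⟨i, j⟩, rfl⟩
    · simp [ι_mul_relation, hτ, hr]
    · simp [relation_mul_ι, hτ, hl]
  rw [← hτ i k m, ← LinearMap.mem_ker]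
  exact hle (htop ▸ Submodule.mem_top)

/-- If `c'` leaves nothing in degree three, then `d` independent relations orthogonal to `c'`
have only trivial syzygies in degree three. -/
lemma componentDim_three_of_orthogonal {d' : ℕ} (c : Coeffs K n d) (c' : Coeffs K n d')
    (hc' : componentDim c' 3 = 0)
    (hli : LinearIndependent K fun j (p : Fin n × Fin n) => c (j, p))
    (horth : ∀ j j', ∑ k, ∑ m, c' (j', k, m) * c (j, k, m) = 0) :
    (componentDim c 3 : ℤ) = (n : ℤ) ^ 3 - 2 * n * d := by
  have hker : ∀ g : Fin d → K, (∀ k m, ∑ j, g j * c (j, k, m) = 0) → ∀ j, g j = 0 :=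
    fun g hg => Fintype.linearIndependent_iff.1 hli g (by
      ext p
      simpa [Finset.sum_apply] using hg p.1 p.2)
  have hpair : ∀ (g : Fin d → K) (j' : Fin d'),
      ∑ k, ∑ m, c' (j', k, m) * ∑ j, g j * c (j, k, m) = 0 := fun g j' => by
    have : ∑ j, g j * ∑ k, ∑ m, c' (j', k, m) * c (j, k, m) = 0 := by simp [horth]
    rw [← this]
    simp only [Finset.mul_sum]
    conv_rhs => rw [Finset.sum_comm]
    refine Finset.sum_congr rfl fun k _ => ?_
    conv_rhs => rw [Finset.sum_comm]
    exact Finset.sum_congr rfl fun m _ => Finset.sum_congr rfl fun j _ => mul_left_comm _ _ _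
  have hind : LinearIndependent K (Sum.elim
      (fun p : Fin n × Fin d => coords K n 3 (FreeAlgebra.ι K p.1 * relation c p.2))
      (fun p : Fin n × Fin d => coords K n 3 (relation c p.2 * FreeAlgebra.ι K p.1))) := by
    rw [Fintype.linearIndependent_iff]
    intro g hg
    have hg' : ∀ i k m, (∑ j, g (Sum.inl (i, j)) * c (j, k, m)) +
        ∑ j, g (Sum.inr (m, j)) * c (j, i, k) = 0 := fun i k m => by
      have := congrFun hg ![i, k, m]
      simpa [Finset.sum_apply, Fintype.sum_prod_type, coords_ι_mul_relation,
        coords_relation_mul_ι, Finset.sum_comm (γ := Fin d)] using this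
    have hT : ∀ i k m, ∑ j, g (Sum.inl (i, j)) * c (j, k, m) = 0 :=
      eq_zero_of_orthogonal c' hc' _ (fun i j' => hpair _ j') fun i j' => by
        have := hpair (fun j => g (Sum.inr (i, j))) j'
        rw [← neg_eq_zero, ← Finset.sum_neg_distrib, ← this]
        refine Finset.sum_congr rfl fun k _ => ?_
        rw [← Finset.sum_neg_distrib]
        refine Finset.sum_congr rfl fun m _ => ?_
        rw [eq_neg_of_add_eq_zero_left (hg' k m i), mul_neg, neg_neg]
    rintro (⟨i, j⟩ | ⟨i, j⟩)
    · exact hker (fun j => g (Sum.inl (i, j))) (hT i) j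
    · refine hker (fun j => g (Sum.inr (i, j))) (fun k m => ?_) j
      have := hg' k m i
      rwa [hT, zero_add] at this
  have h1 := componentDim_add_finrank c 3
  rw [relCoords_three, finrank_span_eq_card hind] at h1
  simp only [Fintype.card_sum, Fintype.card_prod, Fintype.card_fin] at h1
  zify at h1
  linarith

lemma exists_componentDim_three_eq (h : 2 * d ≤ n ^ 2) :
    ∃ c : Coeffs K n d, (componentDim c 3 : ℤ) = (n : ℤ) ^ 3 - 2 * n * d := by
  obtain ⟨c', hc'⟩ := exists_componentDim_three_eq_zero (K := K) (n := n) (d := n ^ 2 - d)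
    (by omega)
  let M : Matrix (Fin (n ^ 2 - d)) (Fin n × Fin n) K := Matrix.of fun j p => c' (j, p)
  have hker : d ≤ finrank K (LinearMap.ker M.mulVecLin) := by
    have h1 := M.mulVecLin.finrank_range_add_finrank_ker
    have h2 := (LinearMap.range M.mulVecLin).finrank_le
    simp only [finrank_fintype_fun_eq_card, Fintype.card_prod, Fintype.card_fin, ← pow_two] at h1 h2
    omega
  obtain ⟨f, hf⟩ := exists_linearIndependent_of_le_finrank hker
  have horth : ∀ g ∈ LinearMap.ker M.mulVecLin, ∀ j', ∑ k, ∑ m, c' (j', k, m) * g (k, m) = 0 :=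
    fun g hg j' => by
      have := congrFun (LinearMap.mem_ker.1 hg) j'
      simpa [Matrix.mulVec, dotProduct, Fintype.sum_prod_type, M] using this
  exact ⟨fun p => (f p.1 : Fin n × Fin n → K) p.2,
    componentDim_three_of_orthogonal _ c' hc' (hf.map' (Submodule.subtype _) (by simp))
      fun j j' => horth _ (f j).2 j'⟩

lemma exists_linearIndependent_relation (hd : d ≤ n ^ 2) :
    ∃ c : Coeffs K n d, LinearIndependent K (relation c) := by
  obtain ⟨f⟩ : Nonempty (Fin d ↪ Fin n × Fin n) :=
    Function.Embedding.nonempty_of_card_le (by simpa [← pow_two] using hd)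
  have hinj : Function.Injective fun j => FreeMonoid.ofList [(f j).1, (f j).2] := fun j j' hjj => by
    have := FreeMonoid.ofList.injective hjj
    simp only [List.cons.injEq, and_true] at this
    exact f.injective (Prod.ext this.1 this.2)
  have h := (FreeAlgebra.basisFreeMonoid K (Fin n)).linearIndependent.comp _ hinj
  simp only [Function.comp_def, basisFreeMonoid_ofList] at h
  have heq : relation (fun p => if f p.1 = p.2 then 1 else 0) =
      fun j => word K [(f j).1, (f j).2] := by
    ext1 j
    simp [relation, word, Prod.ext_iff, ite_and]
  exact ⟨fun p => if f p.1 = p.2 then 1 else 0, heq ▸ h⟩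

/-! ### Generic quadratic algebras -/

/-- The coefficients of the Golod–Shafarevich series bound the Hilbert function from below. -/
lemma coeff_golodShafarevich_le (hd : d ≤ n ^ 2) (h : 4 * (n ^ 2 + n) ≤ 9 * d) (c : Coeffs K n d)
    (hc : LinearIndependent K (relation c)) (q : ℕ) :
    PowerSeries.coeff q (golodShafarevich n d) ≤ componentDim c q := by
  rw [coeff_golodShafarevich hd h]
  match q with
  | 0 => simp [componentDim_of_lt_two]
  | 1 => simp [componentDim_of_lt_two]
  | 2 => exact (componentDim_two c hc).ge
  | 3 => exact max_le (by positivity) (le_componentDim_three c)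
  | q + 4 => positivity

lemma exists_polynomial_hilbertSeries_eq (hd : d ≤ n ^ 2) (h : 4 * (n ^ 2 + n) ≤ 9 * d) :
    ∃ P : MvPolynomial (Fin d × Fin n × Fin n) K, P ≠ 0 ∧
      ∀ c : Coeffs K n d, MvPolynomial.eval c P ≠ 0 →
        LinearIndependent K (relation c) ∧ hilbertSeries c = golodShafarevich n d := by
  obtain ⟨c₂, hc₂⟩ := exists_linearIndependent_relation (K := K) hd
  obtain ⟨c₃, hc₃⟩ : ∃ c : Coeffs K n d,
      (componentDim c 3 : ℤ) ≤ max 0 ((n : ℤ) ^ 3 - 2 * n * d) := by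
    rcases le_total (2 * d) (n ^ 2) with hnd | hnd
    · obtain ⟨c, hc⟩ := exists_componentDim_three_eq (K := K) hnd
      exact ⟨c, hc ▸ le_max_right _ _⟩
    · obtain ⟨c, hc⟩ := exists_componentDim_three_eq_zero (K := K) hnd
      exact ⟨c, by simp [hc]⟩
  obtain ⟨c₄, hc₄⟩ : ∃ c : Coeffs K n d, componentDim c 4 = 0 := by
    rcases lt_or_ge (2 * d) (n ^ 2) with hnd | hnd
    · exact exists_componentDim_four_eq_zero h hnd
    · obtain ⟨c, hc⟩ := exists_componentDim_three_eq_zero (K := K) hnd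
      exact ⟨c, componentDim_eq_zero_of_le c (by norm_num) hc⟩
  obtain ⟨P₂, h₂, hP₂⟩ := exists_polynomial_componentDim_le c₂ 2
  obtain ⟨P₃, h₃, hP₃⟩ := exists_polynomial_componentDim_le c₃ 3
  obtain ⟨P₄, h₄, hP₄⟩ := exists_polynomial_componentDim_le c₄ 4
  have hne : ∀ {P : MvPolynomial (Fin d × Fin n × Fin n) K} {c},
      MvPolynomial.eval c P ≠ 0 → P ≠ 0 := by
    rintro _ c hP rfl
    simp at hP
  refine ⟨P₂ * P₃ * P₄, mul_ne_zero (mul_ne_zero (hne h₂) (hne h₃)) (hne h₄), fun c hc => ?_⟩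
  simp only [map_mul, mul_ne_zero_iff] at hc
  obtain ⟨⟨hcP₂, hcP₃⟩, hcP₄⟩ := hc
  have hle₂ := hP₂ c hcP₂
  have hle₃ := hP₃ c hcP₃
  have h4 : componentDim c 4 = 0 := Nat.le_zero.1 (hc₄ ▸ hP₄ c hcP₄)
  have hli : LinearIndependent K (relation c) := by
    apply linearIndependent_of_componentDim_two_le
    rw [← componentDim_two c₂ hc₂]
    exact_mod_cast hle₂
  refine ⟨hli, ?_⟩
  ext q
  refine le_antisymm ?_ (by simpa [hilbertSeries] using coeff_golodShafarevich_le hd h c hli q)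
  rw [hilbertSeries, PowerSeries.coeff_mk, coeff_golodShafarevich hd h]
  match q with
  | 0 => simp [componentDim_of_lt_two]
  | 1 => simp [componentDim_of_lt_two]
  | 2 => exact (componentDim_two c hli).le
  | 3 => exact le_trans (by exact_mod_cast hle₃) hc₃
  | q + 4 => simp [componentDim_eq_zero_of_le c (Nat.le_add_left 4 q) h4]

end QuadAlg

theorem theorem1 (K : Type*) [Field K] [Infinite K] (n d : ℕ) (hd : d ≤ n ^ 2)
    (h : 4 * ((n : ℚ) ^ 2 + n) / 9 ≤ d) :
    QuadAlg.golodShafarevich n d =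
        1 + PowerSeries.C (n : ℤ) * PowerSeries.X
          + PowerSeries.C ((n : ℤ) ^ 2 - d) * PowerSeries.X ^ 2
          + PowerSeries.C (max 0 ((n : ℤ) ^ 3 - 2 * n * d)) * PowerSeries.X ^ 3 ∧
      QuadAlg.Generically (fun c : QuadAlg.Coeffs K n d =>
        LinearIndependent K (QuadAlg.relation c) ∧
          QuadAlg.hilbertSeries c = QuadAlg.golodShafarevich n d) ∧
      ∀ q : ℕ, IsLeast
        {a : ℤ | ∃ c : QuadAlg.Coeffs K n d, LinearIndependent K (QuadAlg.relation c) ∧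
          a = (QuadAlg.componentDim c q : ℤ)}
        (PowerSeries.coeff q (QuadAlg.golodShafarevich n d)) := by
  have h9 := QuadAlg.le_of_rat_le h
  obtain ⟨P, hP₀, hP⟩ := QuadAlg.exists_polynomial_hilbertSeries_eq (K := K) hd h9
  refine ⟨QuadAlg.golodShafarevich_eq hd h9,
    ⟨{c | MvPolynomial.eval c P ≠ 0}, QuadAlg.isOpen_zariski_setOf_eval_ne_zero P,
      QuadAlg.dense_zariski_setOf_eval_ne_zero hP₀, hP⟩, fun q => ⟨?_, ?_⟩⟩
  · obtain ⟨c, hc⟩ := QuadAlg.exists_eval_ne_zero hP₀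
    obtain ⟨hli, hH⟩ := hP c hc
    exact ⟨c, hli, by rw [← hH, QuadAlg.hilbertSeries, PowerSeries.coeff_mk]⟩
  · rintro _ ⟨c, hli, rfl⟩
    exact QuadAlg.coeff_golodShafarevich_le hd h9 c hli q
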